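/- Let $p$ be a prime, $f\ge 1$, $q=p^f$, $G=\mathrm{GL}_2(\mathbb F_q)$, and let $B\subset G$ be the subgroup of upper triangular matrices. For a tuple $r=(r_0,\dots,r_{f-1})$ of non-negative integers let $V_r$ be the space of polynomials over $\mathbb F_q$ in $x_0,y_0,\dots,x_{f-1},y_{f-1}$ that are homogeneous of degree $r_i$ in $(x_i,y_i)$ for every $i$, with $g=\begin{pmatrix}a&b\\c&d\end{pmatrix}\in G$ acting by $x_i\mapsto a^{p^i}x_i+c^{p^i}y_i$, $y_i\mapsto b^{p^i}x_i+d^{p^i}y_i$ (so that $V_r\cong\bigotimes_{i}\mathrm{Sym}^{r_i}\mathbb F_q^2\circ\mathrm{Fr}^i$). Put $\theta_i=x_iy_{i-1}^p-y_ix_{i-1}^p$, with indices modulo $f$. For $m\ge 0$ let $V_r^{(m)}=\langle\theta_0^{m},\dots,\theta_{f-1}^{m}\rangle=\sum_i\langle\theta_i^m\rangle\subset V_r$, where $\langle h\rangle$ denotes the submodule of all elements of $V_r$ divisible by $h$; in particular $V_r^{(0)}=V_r$. A principal series is a representation of $G$ isomorphic to $\mathrm{ind}_B^G\chi$ for some character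 $\chi:B\to\mathbb F_q^\times$. A representation $V$ of $G$ is said to be decomposable into $N$ principal series if it has a filtration $0=M_0\subset M_1\subset\dots\subset M_N=V$ by submodules such that each of the $N$ successive subquotients $M_{j}/M_{j-1}$ is a principal series. Let $m\ge 0$ and suppose that $r_i\ge m+mq+q$ for all $i$. Then: 1. $V_r^{(m)}/V_r^{(m+1)}$ is decomposable into $(m+1)^f-m^f$ principal series. 2. $V_r/V_r^{(m+1)}$ is decomposable into $(m+1)^f$ principal series. -/

import Mathlib

open MvPolynomial

/-! ### Subquotients, principal series, decomposability -/

namespace Representation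

section Subquotients

variable {k G V : Type*} [CommRing k] [Monoid G] [AddCommGroup V] [Module k V]

/-- The quotient representation `V / U` of a representation `V` by a subrepresentation `U`. -/
def quotientBy (ρ : Representation k G V) (U : Subrepresentation ρ) :
    Representation k G (V ⧸ U.toSubmodule) :=
  ρ.quotient U.toSubmodule (fun g _ hv => U.apply_mem_toSubmodule g hv)

/-- The subquotient `W / U` of a representation, for subrepresentations `U ⊆ W`
(in general `W / (W ∩ U)`). -/
def subquotient (ρ : Representation k G V) (W U : Subrepresentation ρ) :
    Representation k G (W.toSubmodule ⧸ U.toSubmodule.comap W.toSubmodule.subtype) :=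
  W.toRepresentation.quotient (U.toSubmodule.comap W.toSubmodule.subtype)
    (fun g _ hv => U.apply_mem_toSubmodule g hv)

/-- The one-dimensional representation attached to a character `χ : G → kˣ`. -/
def ofCharacter (χ : G →* kˣ) : Representation k G k where
  toFun g := (χ g : k) • LinearMap.id
  map_one' := by ext; simp
  map_mul' g h := by ext; simp [mul_comm]

end Subquotients

end Representation

/-- The Borel subgroup `B(F)` of upper triangular matrices in `GL₂(F)`. -/
def borelSubgroup (F : Type*) [Field F] : Subgroup (GL (Fin 2) F) where
  carrier := {g | g.val 1 0 = 0}
  one_mem' := by simp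
  mul_mem' {a b} ha hb := by
    simp only [Set.mem_ofPred_eq] at ha hb ⊢
    simp [Matrix.mul_apply, Fin.sum_univ_two, ha, hb]
  inv_mem' {a} ha := by
    simp only [Set.mem_ofPred_eq] at ha ⊢
    simp [Matrix.coe_units_inv, Matrix.inv_def, Matrix.adjugate_fin_two, ha]

/-- `ind_B^G χ`, for a character `χ` of the Borel subgroup `B` of `G = GL₂(F)`: the functions
`φ : G → F` with `φ (b g) = χ b * φ g` for all `b ∈ B`, where `G` acts by right translation. -/
abbrev indBorel {F : Type*} [Field F] (χ : borelSubgroup F →* Fˣ) :=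
  Representation.coind (borelSubgroup F).subtype (Representation.ofCharacter χ)

/-- A representation of `GL₂(F)` is a principal series if it is isomorphic to `ind_B^G χ` for some
character `χ : B(F) → Fˣ`. -/
def IsPrincipalSeries {F V : Type*} [Field F] [AddCommGroup V] [Module F V]
    (ρ : Representation F (GL (Fin 2) F) V) : Prop :=
  ∃ χ : borelSubgroup F →* Fˣ, Nonempty (ρ.Equiv (indBorel χ))

/-- `ρ` is decomposable into `N` principal series: there is a filtration
`0 = M₀ ⊆ M₁ ⊆ ⋯ ⊆ M_N = V` by subrepresentations all of whose `N` successive subquotients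
`Mᵢ₊₁ / Mᵢ` are principal series. -/
def DecomposableIntoPrincipalSeries {F V : Type*} [Field F] [AddCommGroup V] [Module F V]
    (ρ : Representation F (GL (Fin 2) F) V) (N : ℕ) : Prop :=
  ∃ M : Fin (N + 1) → Subrepresentation ρ,
    Monotone M ∧ M 0 = ⊥ ∧ M (Fin.last N) = ⊤ ∧
      ∀ i : Fin N, IsPrincipalSeries (ρ.subquotient (M i.succ) (M i.castSucc))

/-! ### The representations `V_r` -/

section SymmetricPowers

variable (p f : ℕ) (F : Type*) [Field F]

/-- The polynomial ring over `F` in the variables `xᵢ = X (i, 0)`, `yᵢ = X (i, 1)`,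
`i = 0, …, f - 1`. -/
abbrev TwistedPoly := MvPolynomial (Fin f × Fin 2) F

/-- The substitution `xᵢ ↦ a^(p^i) xᵢ + c^(p^i) yᵢ`, `yᵢ ↦ b^(p^i) xᵢ + d^(p^i) yᵢ` given by
`g = (a, b; c, d)`. -/
noncomputable def twistedSubst (g : Matrix (Fin 2) (Fin 2) F) :
    TwistedPoly f F →ₐ[F] TwistedPoly f F :=
  aeval fun v => ∑ l : Fin 2, C (g l v.2 ^ p ^ (v.1 : ℕ)) * X (v.1, l)

/-- The action of `GL₂(F)` on the polynomial ring by twisted substitutions. -/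
noncomputable def twistedPolyRep [Fact p.Prime] [CharP F p] :
    Representation F (GL (Fin 2) F) (TwistedPoly f F) where
  toFun g := (twistedSubst p f F g.val).toLinearMap
  map_one' := by
    have h : twistedSubst p f F 1 = AlgHom.id F _ := by
      ext1 v
      obtain ⟨i, k⟩ := v
      have hp : p ≠ 0 := (Fact.out : p.Prime).ne_zero
      fin_cases k <;> simp [twistedSubst, Fin.sum_univ_two, hp]
    simp [h]
    rfl
  map_mul' g h := by
    have hgh : twistedSubst p f F (g.val * h.val) =
        (twistedSubst p f F g.val).comp (twistedSubst p f F h.val) := by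
      ext1 v
      obtain ⟨i, k⟩ := v
      simp only [twistedSubst, aeval_X, AlgHom.comp_apply, Fin.sum_univ_two, map_add, map_mul,
        algHom_C, Matrix.mul_apply, add_pow_char_pow, mul_pow, algebraMap_eq]
      ring
    simp [hgh]
    rfl

/-- The weight of a variable: `xᵢ` and `yᵢ` have multidegree the `i`-th unit vector. -/
def multiWeight (v : Fin f × Fin 2) : Fin f → ℕ := Pi.single v.1 1

theorem isWeightedHomogeneous_twistedSubst (g : Matrix (Fin 2) (Fin 2) F) {r : Fin f → ℕ}
    {P : TwistedPoly f F} (hP : IsWeightedHomogeneous (multiWeight f) P r) :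
    IsWeightedHomogeneous (multiWeight f) (twistedSubst p f F g P) r := by
  have key : ∀ v : Fin f × Fin 2, IsWeightedHomogeneous (multiWeight f)
      (∑ l : Fin 2, C (g l v.2 ^ p ^ (v.1 : ℕ)) * X (v.1, l) : TwistedPoly f F)
      (multiWeight f v) := fun v =>
    IsWeightedHomogeneous.sum _ _ _ fun l _ => (isWeightedHomogeneous_X F _ (v.1, l)).C_mul _
  rw [twistedSubst, aeval_def, eval₂_eq]
  refine IsWeightedHomogeneous.sum _ _ _ fun d hd => ?_
  rw [algebraMap_eq]
  refine IsWeightedHomogeneous.C_mul ?_ _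
  have h := IsWeightedHomogeneous.prod d.support _ (fun v => d v • multiWeight f v)
    (fun v _ => (key v).pow (d v))
  have hr : ∑ v ∈ d.support, d v • multiWeight f v = r := by
    have := hP (mem_support_iff.1 hd)
    rwa [Finsupp.weight_apply, Finsupp.sum] at this
  rwa [hr] at h

/-- `V_r`, as the subrepresentation of polynomials that are homogeneous of degree `rᵢ` in `xᵢ, yᵢ`
for every `i`. -/
noncomputable def symPower [Fact p.Prime] [CharP F p] (r : Fin f → ℕ) :
    Subrepresentation (twistedPolyRep p f F) where
  toSubmodule := weightedHomogeneousSubmodule F (multiWeight f) r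
  apply_mem_toSubmodule g _ hP := isWeightedHomogeneous_twistedSubst p f F g.val hP

/-- The representation of `GL₂(F)` on `V_r`. -/
noncomputable def symPowerRep [Fact p.Prime] [CharP F p] (r : Fin f → ℕ) :
    Representation F (GL (Fin 2) F) (symPower p f F r).toSubmodule :=
  (symPower p f F r).toRepresentation

/-! ### The theta filtration -/

/-- The twisted Dickson polynomial `θᵢ = xᵢ yᵢ₋₁^p - yᵢ xᵢ₋₁^p`, with indices modulo `f`
(subtraction in `Fin f` is cyclic). -/
noncomputable def theta [NeZero f] (i : Fin f) : TwistedPoly f F :=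
  X (i, 0) * X (i - 1, 1) ^ p - X (i, 1) * X (i - 1, 0) ^ p

/-- `⟨h⟩ ⊆ V_r`: the polynomials in `V_r` that are divisible by `h`. -/
noncomputable def divisibleBy [Fact p.Prime] [CharP F p] (r : Fin f → ℕ) (h : TwistedPoly f F) :
    Submodule F (symPower p f F r).toSubmodule where
  carrier := {P | h ∣ (P : TwistedPoly f F)}
  add_mem' ha hb := dvd_add ha hb
  zero_mem' := dvd_zero h
  smul_mem' c P hP := by
    simp only [Set.mem_ofPred_eq, Submodule.coe_smul, smul_eq_C_mul] at hP ⊢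
    exact hP.mul_left _

theorem pow_pow_val_sub_one [Fact p.Prime] [NeZero f] (hF : Nat.card F = p ^ f) (i : Fin f)
    (a : F) : (a ^ p ^ ((i - 1 : Fin f) : ℕ)) ^ p = a ^ p ^ (i : ℕ) := by
  rw [← pow_mul, ← pow_succ]
  obtain ⟨n, rfl⟩ := Nat.exists_eq_succ_of_ne_zero (NeZero.ne f)
  rw [Fin.coe_sub_one]
  split_ifs with hi
  · subst hi
    have hne : Nat.card F ≠ 0 := by
      rw [hF]
      exact pow_ne_zero _ (Fact.out : p.Prime).ne_zero
    have : Finite F := Nat.finite_of_card_ne_zero hne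
    have : Fintype F := Fintype.ofFinite F
    have h : a ^ p ^ (n + 1) = a := by
      rw [← Nat.succ_eq_add_one, ← hF, Nat.card_eq_fintype_card, FiniteField.pow_card]
    simpa using h
  · have hi' : (i : ℕ) ≠ 0 := fun h => hi (Fin.ext h)
    rw [Nat.sub_add_cancel (by omega)]

/-- `GL₂(F)` acts on `θᵢ` through `det ^ (p ^ i)`. -/
theorem twistedSubst_theta [Fact p.Prime] [CharP F p] [NeZero f] (hF : Nat.card F = p ^ f)
    (g : Matrix (Fin 2) (Fin 2) F) (i : Fin f) :
    twistedSubst p f F g (theta p f F i) = C (g.det ^ p ^ (i : ℕ)) * theta p f F i := by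
  simp only [theta, twistedSubst, map_sub, map_mul, map_pow, aeval_X, Fin.sum_univ_two,
    add_pow_char, mul_pow, Matrix.det_fin_two, sub_pow_char_pow]
  simp only [← map_pow, pow_pow_val_sub_one p f F hF]
  simp only [map_pow]
  ring

/-- `V_r^{(m)} = ⟨θ₀^m, …, θ_{f-1}^m⟩ ⊆ V_r`, the sum of the submodules `⟨θᵢ^m⟩`, when `F` has
`p ^ f` elements. -/
noncomputable def thetaPower [Fact p.Prime] [CharP F p] [NeZero f] (hF : Nat.card F = p ^ f)
    (r : Fin f → ℕ) (m : ℕ) : Subrepresentation (symPowerRep p f F r) where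
  toSubmodule := ⨆ i : Fin f, divisibleBy p f F r (theta p f F i ^ m)
  apply_mem_toSubmodule g := by
    suffices h : (⨆ i : Fin f, divisibleBy p f F r (theta p f F i ^ m)) ≤
        (⨆ i : Fin f, divisibleBy p f F r (theta p f F i ^ m)).comap (symPowerRep p f F r g) from
      fun v hv => h hv
    refine iSup_le fun i P hP => Submodule.mem_comap.2 (Submodule.mem_iSup_of_mem i ?_)
    obtain ⟨Q, hQ⟩ := hP
    change theta p f F i ^ m ∣ twistedSubst p f F g.val (P : TwistedPoly f F)
    rw [hQ, map_mul, map_pow, twistedSubst_theta p f F hF, mul_pow, mul_assoc]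
    exact (dvd_mul_right _ _).mul_left _

/-- The theta filtration is decreasing. -/
theorem thetaPower_succ_le [Fact p.Prime] [CharP F p] [NeZero f] (hF : Nat.card F = p ^ f)
    (r : Fin f → ℕ) (m : ℕ) : thetaPower p f F hF r (m + 1) ≤ thetaPower p f F hF r m := by
  refine (iSup_mono fun i P hP => ?_ : (⨆ i : Fin f, divisibleBy p f F r (theta p f F i ^ (m + 1)))
    ≤ ⨆ i : Fin f, divisibleBy p f F r (theta p f F i ^ m))
  exact dvd_trans (pow_dvd_pow _ m.le_succ) hP

/-- `V_r^{(0)} = V_r`. -/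
theorem thetaPower_zero [Fact p.Prime] [CharP F p] [NeZero f] (hF : Nat.card F = p ^ f)
    (r : Fin f → ℕ) : thetaPower p f F hF r 0 = ⊤ := by
  refine top_le_iff.1 fun P _ => ?_
  refine Submodule.mem_iSup_of_mem (0 : Fin f) ?_
  change theta p f F 0 ^ 0 ∣ (P : TwistedPoly f F)
  simp

end SymmetricPowers

/-! Write θ^b for ∏ θ_i^{b_i} and filter V_r by the sums of the submodules ⟨θ^b⟩, b in a set of
exponents. The exponents with some b_i ≥ m+1 give V_r^{(m+1)}; the remaining ones are adjoined one
at a time, larger ones before smaller ones. The whole box [0,m]^f leads up to V_r, and the box minus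
[0,m-1]^f leads up to V_r^{(m)}, which explains the two counts. Each adjoined exponent contributes
one principal series.

Adjoining a adds θ^a V_{r'}, where r' = r - deg θ^a. Since every a + e_i is already present, θ^a
V_{r'}^{(1)} is old, and the step is a principal series because of two facts.

(i) V_{r'}/V_{r'}^{(1)} is the space of restrictions to the points x_i = a^{p^i}, y_i = b^{p^i} with
a, b in F_q. All θ_i vanish there. Conversely, rewriting x_i y_{i-1}^p as y_i x_{i-1}^p reduces
every monomial to one of q+1 normal forms, and these are separated by the q+1 points of P^1(F_q)
(`mem_thetaPower_one_of_evalPoint_eq_zero`, `exists_evalPoint_normalForm_eq`).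

(ii) θ^a Q is old only if Q vanishes at these points. Near (0,1) the θ_i are local coordinates z_i:
with y_i = 1, solving x_i = z_i + x_{i-1}^p gives x_i = z_i + z_{i-1}^p + ⋯. The coefficient of z^a
kills every multiple of θ^b with b ≰ a and sends θ^a Q to Q(0,1). Taken on all translates by G, it
becomes an equivariant map to ind_B^G χ (`exists_thetaSpan_insert_to_indBorel`). -/

/-! ### Transporting chains of subrepresentations to quotients. -/

section Decomposition

variable {F : Type*} [Field F]

/-- A representation `τ` is a principal series as soon as it and some `ind_B^G χ` are quotients of
the same representation by the same kernel. -/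
theorem IsPrincipalSeries.of_ker_eq {Y Z : Type*} [AddCommGroup Y] [Module F Y] [AddCommGroup Z]
    [Module F Z] (ρ : Representation F (GL (Fin 2) F) Y) (τ : Representation F (GL (Fin 2) F) Z)
    (χ : borelSubgroup F →* Fˣ) (α : Y →ₗ[F] Z) (hα : Function.Surjective α)
    (hαρ : ∀ g y, α (ρ g y) = τ g (α y))
    (β : Y →ₗ[F] Representation.coindV (borelSubgroup F).subtype (Representation.ofCharacter χ))
    (hβ : Function.Surjective β) (hβρ : ∀ g y, β (ρ g y) = indBorel χ g (β y))
    (hker : LinearMap.ker α = LinearMap.ker β) : IsPrincipalSeries τ := by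
  let e := (α.quotKerEquivOfSurjective hα).symm ≪≫ₗ
    Submodule.quotEquivOfEq _ _ hker ≪≫ₗ β.quotKerEquivOfSurjective hβ
  have he : ∀ y, e (α y) = β y := fun y => by
    have : (α.quotKerEquivOfSurjective hα).symm (α y) = Submodule.Quotient.mk y := by
      rw [LinearEquiv.symm_apply_eq]; rfl
    simp only [e, LinearEquiv.trans_apply, this]
    rfl
  refine ⟨χ, ⟨Representation.Equiv.mk e fun g => LinearMap.ext fun z => ?_⟩⟩
  obtain ⟨y, rfl⟩ := hα z
  change e (τ g (α y)) = indBorel χ g (e (α y))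
  rw [← hαρ, he, he, hβρ]

/-- A chain of subrepresentations of `ρ` from `ker π` to `W`, all of whose steps are principal
series, induces a decomposition of the image of `π : W → X`. -/
theorem DecomposableIntoPrincipalSeries.of_chain {V X : Type*} [AddCommGroup V] [Module F V]
    [AddCommGroup X] [Module F X] {ρ : Representation F (GL (Fin 2) F) V}
    {σ : Representation F (GL (Fin 2) F) X} (W : Subrepresentation ρ) (π : W.toSubmodule →ₗ[F] X)
    (hπ : Function.Surjective π) (hπρ : ∀ g w, π (W.toRepresentation g w) = σ g (π w))
    {N : ℕ} (M : Fin (N + 1) → Subrepresentation ρ) (hM : Monotone M) (hlast : M (Fin.last N) = W)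
    (hker : ∀ w, π w = 0 ↔ (w : V) ∈ (M 0).toSubmodule)
    (hstep : ∀ i : Fin N, ∃ (χ : borelSubgroup F →* Fˣ) (β : (M i.succ).toSubmodule →ₗ[F]
      Representation.coindV (borelSubgroup F).subtype (Representation.ofCharacter χ)),
      Function.Surjective β ∧
      (∀ g y, β ((M i.succ).toRepresentation g y) = indBorel χ g (β y)) ∧
      ∀ y, β y = 0 ↔ (y : V) ∈ (M i.castSucc).toSubmodule) :
    DecomposableIntoPrincipalSeries σ N := by
  have hMW : ∀ i, (M i).toSubmodule ≤ W.toSubmodule := fun i => by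
    rw [← hlast]; exact hM (Fin.le_last i)
  have hM' : ∀ {i j}, i ≤ j → (M i).toSubmodule ≤ (M j).toSubmodule := fun h => hM h
  let M' : Fin (N + 1) → Subrepresentation σ := fun i =>
    { toSubmodule := ((M i).toSubmodule.comap W.toSubmodule.subtype).map π
      apply_mem_toSubmodule := by
        rintro g _ ⟨w, hw, rfl⟩
        rw [← hπρ]
        exact ⟨_, (M i).apply_mem_toSubmodule g hw, rfl⟩ }
  refine ⟨M', fun i j hij => Submodule.map_mono (Submodule.comap_mono (hM' hij)), ?_, ?_, fun i => ?_⟩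
  · refine le_bot_iff.1 ?_
    rintro _ ⟨w, hw, rfl⟩
    exact (hker w).2 hw
  · refine top_le_iff.1 fun x _ => ?_
    obtain ⟨w, rfl⟩ := hπ x
    refine ⟨w, ?_, rfl⟩
    change (w : V) ∈ (M (Fin.last N)).toSubmodule
    rw [hlast]
    exact w.2
  · obtain ⟨χ, β, hβ, hβρ, hβ0⟩ := hstep i
    let γ : (M i.succ).toSubmodule →ₗ[F] (M' i.succ).toSubmodule :=
      (π ∘ₗ Submodule.inclusion (hMW i.succ)).codRestrict _
        fun y => ⟨Submodule.inclusion (hMW i.succ) y, y.2, rfl⟩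
    refine IsPrincipalSeries.of_ker_eq (M i.succ).toRepresentation _ χ
      (((M' i.castSucc).toSubmodule.comap (M' i.succ).toSubmodule.subtype).mkQ ∘ₗ γ)
      ?_ ?_ β hβ hβρ ?_
    · refine (Submodule.mkQ_surjective _).comp ?_
      rintro ⟨_, w, hw, rfl⟩
      exact ⟨⟨w, hw⟩, rfl⟩
    · intro g y
      refine congrArg (Submodule.Quotient.mk) (Subtype.ext ?_)
      exact hπρ g (Submodule.inclusion (hMW i.succ) y)
    · ext y
      rw [LinearMap.mem_ker, LinearMap.mem_ker, hβ0, LinearMap.comp_apply, Submodule.mkQ_apply,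
        Submodule.Quotient.mk_eq_zero]
      constructor
      · rintro ⟨w, hw, hwy⟩
        -- Two preimages of the same vector differ by an element of ker π = `M 0`, which lies in
        -- every term of the chain.
        have h0 : π (Submodule.inclusion (hMW i.succ) y - w) = 0 := by
          rw [map_sub, hwy]; exact sub_self _
        have h1 := hM' (Fin.zero_le i.castSucc) ((hker _).1 h0)
        have h2 := add_mem h1 hw
        simpa using h2
      · intro hy
        exact ⟨Submodule.inclusion (hMW i.succ) y, hy, rfl⟩

end Decomposition

/-! ### Monomials and multidegrees. -/

section BihomogeneousMonomials

variable (f : ℕ) (F : Type*) [Field F]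

/-- The monomial `∏ xᵢ ^ uᵢ * yᵢ ^ vᵢ`. -/
noncomputable def xyMonomial (u v : Fin f → ℕ) : TwistedPoly f F :=
  ∏ i, (X (i, 0) ^ u i * X (i, 1) ^ v i)

variable {f F}

theorem xyMonomial_add (u v u' v' : Fin f → ℕ) :
    xyMonomial f F (u + u') (v + v') = xyMonomial f F u v * xyMonomial f F u' v' := by
  simp only [xyMonomial, Pi.add_apply, pow_add, ← Finset.prod_mul_distrib]
  exact Finset.prod_congr rfl fun i _ => by ring

theorem xyMonomial_single (i j : Fin f) (a b : ℕ) :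
    xyMonomial f F (Pi.single i a) (Pi.single j b) = X (i, 0) ^ a * X (j, 1) ^ b := by
  classical
  rw [xyMonomial, Finset.prod_mul_distrib, Fintype.prod_eq_single i, Fintype.prod_eq_single j]
  · simp
  · intro k hk; simp [hk]
  · intro k hk; simp [hk]

theorem sum_single_eq (u : Fin f → ℕ) : ∑ i, u i • (Pi.single i 1 : Fin f → ℕ) = u := by
  funext j
  simp [Finset.sum_apply, Pi.single_apply]

theorem isWeightedHomogeneous_xyMonomial (u v : Fin f → ℕ) :
    IsWeightedHomogeneous (multiWeight f) (xyMonomial f F u v) (u + v) := by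
  have h := IsWeightedHomogeneous.prod (w := multiWeight f) Finset.univ
    (fun i => (X (i, 0) ^ u i * X (i, 1) ^ v i : TwistedPoly f F))
    (fun i => u i • (Pi.single i 1 : Fin f → ℕ) + v i • (Pi.single i 1 : Fin f → ℕ))
    (fun i _ => ((isWeightedHomogeneous_X F (multiWeight f) (i, 0)).pow (u i)).mul
      ((isWeightedHomogeneous_X F (multiWeight f) (i, 1)).pow (v i)))
  rwa [Finset.sum_add_distrib, sum_single_eq, sum_single_eq] at h

theorem monomial_eq_xyMonomial (d : Fin f × Fin 2 →₀ ℕ) :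
    monomial d (1 : F) = xyMonomial f F (fun i => d (i, 0)) (fun i => d (i, 1)) := by
  rw [monomial_eq, C_1, one_mul, Finsupp.prod_fintype _ _ (by simp), Fintype.prod_prod_type]
  simp [xyMonomial, Fin.prod_univ_two]

theorem weight_multiWeight (d : Fin f × Fin 2 →₀ ℕ) :
    Finsupp.weight (multiWeight f) d = (fun i => d (i, 0)) + fun i => d (i, 1) := by
  rw [Finsupp.weight_apply, Finsupp.sum_fintype _ _ (by simp), Fintype.sum_prod_type]
  simp only [Fin.sum_univ_two, multiWeight, Finset.sum_add_distrib]
  rw [sum_single_eq (fun i => d (i, 0)), sum_single_eq (fun i => d (i, 1))]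

/-- Multihomogeneous polynomials of degree `r` are spanned by the monomials of degree `r`. -/
theorem mem_of_xyMonomial_mem {r : Fin f → ℕ} (S : Submodule F (TwistedPoly f F))
    (hS : ∀ u v, u + v = r → xyMonomial f F u v ∈ S) {P : TwistedPoly f F}
    (hP : IsWeightedHomogeneous (multiWeight f) P r) : P ∈ S := by
  rw [P.as_sum]
  refine S.sum_mem fun d hd => ?_
  rw [← mul_one (coeff d P), ← smul_eq_mul, ← smul_monomial, monomial_eq_xyMonomial]
  refine S.smul_mem _ (hS _ _ ?_)
  rw [← weight_multiWeight]
  exact hP (mem_support_iff.1 hd)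

/-- A multihomogeneous polynomial divisible by a multihomogeneous polynomial has a multihomogeneous
cofactor. -/
theorem exists_isWeightedHomogeneous_of_dvd {r s : Fin f → ℕ} {P Q : TwistedPoly f F}
    (hP : IsWeightedHomogeneous (multiWeight f) P (s + r))
    (hQ : IsWeightedHomogeneous (multiWeight f) Q s) (h : Q ∣ P) :
    ∃ R, IsWeightedHomogeneous (multiWeight f) R r ∧ P = Q * R := by
  classical
  obtain ⟨R, rfl⟩ := h
  let := weightedGradedAlgebra F (multiWeight f)
  -- As Q is homogeneous of degree s, the degree s + r part of Q * R is Q times the degree r part of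
  -- R.
  refine ⟨DirectSum.decompose (weightedHomogeneousSubmodule F (multiWeight f)) R r,
    (DirectSum.decompose (weightedHomogeneousSubmodule F (multiWeight f)) R r).2, ?_⟩
  rw [← DirectSum.coe_decompose_mul_add_of_left_mem
    (weightedHomogeneousSubmodule F (multiWeight f)) (i := s) (a := Q) hQ]
  exact (DirectSum.decompose_of_mem_same (weightedHomogeneousSubmodule F (multiWeight f)) hP).symm

end BihomogeneousMonomials

/-! ### Evaluation at the rational points. -/

section Points

variable (p f : ℕ) (F : Type*) [Field F]

/-- The evaluation `xᵢ ↦ a ^ (p ^ i)`, `yᵢ ↦ b ^ (p ^ i)`. -/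
noncomputable def evalPoint (a b : F) : TwistedPoly f F →ₐ[F] F :=
  aeval fun v => ![a, b] v.2 ^ p ^ (v.1 : ℕ)

variable {p f F}

theorem evalPoint_xyMonomial (a b : F) (u v : Fin f → ℕ) :
    evalPoint p f F a b (xyMonomial f F u v) =
      ∏ i : Fin f, ((a ^ p ^ (i : ℕ)) ^ u i * (b ^ p ^ (i : ℕ)) ^ v i) := by
  simp [evalPoint, xyMonomial, map_prod]

/-- This exponent of t becomes the power of the lower diagonal entry in the character of B. -/
theorem evalPoint_smul {r : Fin f → ℕ} {P : TwistedPoly f F}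
    (hP : IsWeightedHomogeneous (multiWeight f) P r) (t a b : F) :
    evalPoint p f F (t * a) (t * b) P =
      t ^ (∑ i : Fin f, p ^ (i : ℕ) * r i) * evalPoint p f F a b P := by
  have := mem_of_xyMonomial_mem (LinearMap.eqLocus (evalPoint p f F (t * a) (t * b)).toLinearMap
    (t ^ (∑ i : Fin f, p ^ (i : ℕ) * r i) • (evalPoint p f F a b).toLinearMap)) ?_ hP
  · simpa using! this
  · rintro u v rfl
    change evalPoint p f F _ _ _ = t ^ _ * evalPoint p f F _ _ _
    rw [evalPoint_xyMonomial, evalPoint_xyMonomial, ← Finset.prod_pow_eq_pow_sum,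
      ← Finset.prod_mul_distrib]
    refine Finset.prod_congr rfl fun i _ => ?_
    simp only [Pi.add_apply]
    ring

/-- The point (a, b) is moved as a row vector; hence translates evaluated at (0, 1) see the bottom
row of g, which parametrizes the cosets of B up to scaling. -/
theorem evalPoint_twistedSubst (a b : F) (g : Matrix (Fin 2) (Fin 2) F) [Fact p.Prime] [CharP F p]
    (P : TwistedPoly f F) :
    evalPoint p f F a b (twistedSubst p f F g P) =
      evalPoint p f F (a * g 0 0 + b * g 1 0) (a * g 0 1 + b * g 1 1) P := by
  rw [← AlgHom.comp_apply]
  congr 1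
  ext v
  obtain ⟨i, k⟩ := v
  fin_cases k <;>
  simp [evalPoint, twistedSubst, Fin.sum_univ_two, add_pow_char_pow, mul_pow] <;> ring

variable [Fact p.Prime] [NeZero f]

theorem evalPoint_theta (hF : Nat.card F = p ^ f) (a b : F) (i : Fin f) :
    evalPoint p f F a b (theta p f F i) = 0 := by
  simp only [evalPoint, theta, map_sub, map_mul, map_pow, aeval_X]
  simp [pow_pow_val_sub_one p f F hF, mul_comm]

end Points

/-! ### Normal forms and interpolation on the q + 1 points of P^1(F_q). -/

section NormalForm

variable (p f : ℕ) (F : Type*) [Field F]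

/-- The span of `∏ yᵢ ^ rᵢ` and of the monomials of multidegree `r` whose exponents in the `yᵢ` are
digits in base `p`, given by their coefficients. -/
noncomputable def normalForm (r : Fin f → ℕ) : ((Fin f → Fin p) → F) × F →ₗ[F] TwistedPoly f F where
  toFun c := ∑ k, c.1 k • xyMonomial f F (fun i => r i - k i) (fun i => k i) +
    c.2 • xyMonomial f F 0 r
  map_add' c d := by
    simp only [Prod.fst_add, Prod.snd_add, Pi.add_apply, add_smul, Finset.sum_add_distrib]
    abel
  map_smul' c d := by
    simp [mul_smul, Finset.smul_sum]

variable {p f F}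

theorem isWeightedHomogeneous_normalForm {r : Fin f → ℕ} (hr : ∀ i, p ≤ r i)
    (c : ((Fin f → Fin p) → F) × F) :
    IsWeightedHomogeneous (multiWeight f) (normalForm p f F r c) r := by
  have h : ∀ u v, u + v = r →
      xyMonomial f F u v ∈ weightedHomogeneousSubmodule F (multiWeight f) r := fun u v huv => by
    rw [← huv]; exact isWeightedHomogeneous_xyMonomial u v
  refine (weightedHomogeneousSubmodule F (multiWeight f) r).add_mem
    (Submodule.sum_mem _ fun k _ => Submodule.smul_mem _ _ (h _ _ ?_))
    (Submodule.smul_mem _ _ (h _ _ (zero_add r)))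
  funext i
  exact Nat.sub_add_cancel ((k i).2.le.trans (hr i))

theorem evalPoint_zero_one_normalForm [Fact p.Prime] [NeZero f] {r : Fin f → ℕ} (hr : ∀ i, p ≤ r i)
    (c : ((Fin f → Fin p) → F) × F) : evalPoint p f F 0 1 (normalForm p f F r c) = c.2 := by
  simp only [normalForm, LinearMap.coe_mk, AddHom.coe_mk, map_add, map_sum, map_smul,
    evalPoint_xyMonomial]
  rw [Finset.sum_eq_zero]
  · simp
  · intro k _
    rw [Finset.prod_eq_zero (Finset.mem_univ 0), smul_zero]
    -- A positive power of x_0 remains, and it vanishes at (0, 1).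
    have : r 0 - (k 0 : ℕ) ≠ 0 := by have := hr 0; have := (k 0).2; omega
    simp [this]

/-- Reading the y-exponents as base p digits gives each power of a from 0 to q - 1 exactly once. -/
theorem evalPoint_one_normalForm (r : Fin f → ℕ) (c : ((Fin f → Fin p) → F) × F) (a : F) :
    evalPoint p f F 1 a (normalForm p f F r c) =
      ∑ t : Fin (p ^ f), c.1 (finFunctionFinEquiv.symm t) * a ^ (t : ℕ) +
        c.2 * a ^ (∑ i : Fin f, p ^ (i : ℕ) * r i) := by
  simp only [normalForm, LinearMap.coe_mk, AddHom.coe_mk, map_add, map_sum, map_smul,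
    evalPoint_xyMonomial, one_pow, one_mul, smul_eq_mul, ← pow_mul, Finset.prod_pow_eq_pow_sum]
  congr 1
  rw [← finFunctionFinEquiv.sum_comp]
  refine Finset.sum_congr rfl fun k _ => ?_
  simp [mul_comm]

variable [Fintype F]

/-- A normal form that vanishes at all rational points is zero. -/
theorem eq_zero_of_evalPoint_normalForm_eq_zero [Fact p.Prime] [NeZero f] (hF : Nat.card F = p ^ f)
    {r : Fin f → ℕ} (hr : ∀ i, p ≤ r i) {c : ((Fin f → Fin p) → F) × F}
    (h0 : evalPoint p f F 0 1 (normalForm p f F r c) = 0)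
    (h1 : ∀ a, evalPoint p f F 1 a (normalForm p f F r c) = 0) : c = 0 := by
  rw [evalPoint_zero_one_normalForm hr] at h0
  simp only [evalPoint_one_normalForm, h0, zero_mul, add_zero] at h1
  -- A polynomial of degree less than q that vanishes on all of F_q is zero.
  have hz := Polynomial.eq_zero_of_natDegree_lt_card_of_eval_eq_zero
    (∑ t : Fin (p ^ f), Polynomial.monomial (t : ℕ) (c.1 (finFunctionFinEquiv.symm t)))
    (f := (id : F → F)) Function.injective_id (fun a => by
      simpa [Polynomial.eval_finsetSum] using h1 a) (by
      rw [← Nat.card_eq_fintype_card, hF]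
      have hpos : 0 < p ^ f := pow_pos (Fact.out : p.Prime).pos _
      refine Nat.lt_of_le_pred hpos (Polynomial.natDegree_sum_le_of_forall_le _ _ fun t _ => ?_)
      exact (Polynomial.natDegree_monomial_le _).trans (Nat.le_pred_of_lt t.2))
  refine Prod.ext (funext fun k => ?_) h0
  have := congrArg (fun P => Polynomial.coeff P (finFunctionFinEquiv k : ℕ)) hz
  simp only [Polynomial.finsetSum_coeff, Polynomial.coeff_monomial, Fin.val_inj] at this
  rw [Finset.sum_ite_eq' Finset.univ (finFunctionFinEquiv k), if_pos (Finset.mem_univ _)] at this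
  rwa [Equiv.symm_apply_apply, Polynomial.coeff_zero] at this

/-- Normal forms take arbitrary values at representatives of the rational points. -/
theorem exists_evalPoint_normalForm_eq [Fact p.Prime] [NeZero f] (hF : Nat.card F = p ^ f)
    {r : Fin f → ℕ} (hr : ∀ i, p ≤ r i) (b : F) (φ : F → F) :
    ∃ c, evalPoint p f F 0 1 (normalForm p f F r c) = b ∧
      ∀ a, evalPoint p f F 1 a (normalForm p f F r c) = φ a := by
  let L : ((Fin f → Fin p) → F) × F →ₗ[F] (F → F) × F :=
    (LinearMap.pi fun a => (evalPoint p f F 1 a).toLinearMap ∘ₗ normalForm p f F r).prod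
      ((evalPoint p f F 0 1).toLinearMap ∘ₗ normalForm p f F r)
  have hL : Function.Injective L := by
    rw [← LinearMap.ker_eq_bot, LinearMap.ker_eq_bot']
    intro c hc
    exact eq_zero_of_evalPoint_normalForm_eq_zero hF hr (congrArg Prod.snd hc)
      fun a => congrFun (congrArg Prod.fst hc) a
  -- Both sides have dimension q + 1, so injectivity gives surjectivity.
  have hdim : Module.finrank F (((Fin f → Fin p) → F) × F) = Module.finrank F ((F → F) × F) := by
    simp [Module.finrank_prod, ← hF]
  obtain ⟨c, hc⟩ := (LinearMap.injective_iff_surjective_of_finrank_eq_finrank hdim).1 hL (φ, b)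
  exact ⟨c, congrArg Prod.snd hc, fun a => congrFun (congrArg Prod.fst hc) a⟩

end NormalForm

/-! ### Reduction to normal form modulo the θ_i. -/

section Reduction

variable {p f : ℕ} {F : Type*} [Field F]

theorem theta_eq_xyMonomial [NeZero f] (i : Fin f) : theta p f F i =
    xyMonomial f F (Pi.single i 1) (Pi.single (i - 1) p) -
      xyMonomial f F (Pi.single (i - 1) p) (Pi.single i 1) := by
  rw [xyMonomial_single, xyMonomial_single, theta]
  ring

/-- The multidegree of `θᵢ`. -/
theorem isWeightedHomogeneous_theta [NeZero f] (i : Fin f) :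
    IsWeightedHomogeneous (multiWeight f) (theta p f F i) (Pi.single i 1 + Pi.single (i - 1) p) := by
  rw [theta_eq_xyMonomial]
  refine (isWeightedHomogeneous_xyMonomial _ _).sub ?_
  rw [add_comm]
  exact isWeightedHomogeneous_xyMonomial _ _

theorem Pi.single_le_of_le {u : Fin f → ℕ} {i : Fin f} {n : ℕ} (h : n ≤ u i) :
    Pi.single i n ≤ u := fun j => by
  rcases eq_or_ne j i with rfl | hj
  · simpa using h
  · simp [hj]

theorem Fin.forall_of_forall_add_one [NeZero f] {P : Fin f → Prop} (h : ∀ i, P i → P (i + 1))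
    {j : Fin f} (hj : P j) (i : Fin f) : P i := by
  have key : ∀ k : Fin f, ∀ j, P j → P (j + k) := by
    obtain ⟨n, rfl⟩ := Nat.exists_eq_succ_of_ne_zero (NeZero.ne f)
    intro k
    induction k using Fin.induction with
    | zero => intro j hj; simpa using hj
    | succ k ih =>
      intro j hj
      rw [← Fin.coeSucc_eq_succ, ← add_assoc]
      exact h _ (ih j hj)
  have := key (i - j) j hj
  rwa [add_sub_cancel] at this

variable [Fact p.Prime] [CharP F p] [NeZero f]

/-- Modulo the `θᵢ`, every monomial is congruent to a normal form. -/
theorem xyMonomial_mem_thetaPower_sup_normalForm (hF : Nat.card F = p ^ f) {r : Fin f → ℕ}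
    (hr : ∀ i, p ≤ r i) (n : ℕ) (u v : Fin f → ℕ) (huv : u + v = r) (hn : ∑ i, v i = n) :
    xyMonomial f F u v ∈ (thetaPower p f F hF r 1).toSubmodule.map
      (symPower p f F r).toSubmodule.subtype ⊔ LinearMap.range (normalForm p f F r) := by
  classical
  -- Induction on the total y-degree: replacing x_i y_{i-1}^p by y_i x_{i-1}^p lowers it by p - 1.
  induction n using Nat.strong_induction_on generalizing u v with
  | _ n ih =>
  by_cases hi : ∃ i, p ≤ v (i - 1) ∧ 1 ≤ u i
  · obtain ⟨i, hv, hu⟩ := hi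
    obtain ⟨e, rfl⟩ : ∃ e, v = e + Pi.single (i - 1) p :=
      ⟨v - Pi.single (i - 1) p, (tsub_add_cancel_of_le (Pi.single_le_of_le hv)).symm⟩
    obtain ⟨s, rfl⟩ : ∃ s, u = s + Pi.single i 1 :=
      ⟨u - Pi.single i 1, (tsub_add_cancel_of_le (Pi.single_le_of_le hu)).symm⟩
    have hdeg : s + Pi.single (i - 1) p + (e + Pi.single i 1) = r := by rw [← huv]; abel
    have hnext := ih _ ?_ (s + Pi.single (i - 1) p) (e + Pi.single i 1) hdeg rfl
    · have heq : xyMonomial f F (s + Pi.single i 1) (e + Pi.single (i - 1) p) =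
          theta p f F i * xyMonomial f F s e +
            xyMonomial f F (s + Pi.single (i - 1) p) (e + Pi.single i 1) := by
        rw [xyMonomial_add, xyMonomial_add, theta_eq_xyMonomial]
        ring
      rw [heq]
      refine Submodule.add_mem _ (Submodule.mem_sup_left ?_) hnext
      have hhom : IsWeightedHomogeneous (multiWeight f) (theta p f F i * xyMonomial f F s e) r := by
        convert (isWeightedHomogeneous_theta (p := p) (F := F) i).mul
          (isWeightedHomogeneous_xyMonomial s e) using 1
        rw [← hdeg]; abel
      refine ⟨⟨_, hhom⟩, Submodule.mem_iSup_of_mem i ?_, rfl⟩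
      change theta p f F i ^ 1 ∣ theta p f F i * _
      rw [pow_one]
      exact dvd_mul_right _ _
    · rw [← hn]
      have := (Fact.out : p.Prime).one_lt
      simpa [Finset.sum_add_distrib] using this
  · push Not at hi
    refine Submodule.mem_sup_right ?_
    by_cases hv : ∀ i, v i < p
    · refine ⟨(Pi.single (fun i => ⟨v i, hv i⟩) 1, 0), ?_⟩
      have hu : u = fun i => r i - v i := by
        funext i; rw [← huv]; simp
      simp only [normalForm, LinearMap.coe_mk, AddHom.coe_mk, zero_smul, add_zero]
      rw [Fintype.sum_eq_single (fun i => ⟨v i, hv i⟩) fun k hk => by simp [hk]]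
      simp [hu]
    · push Not at hv
      obtain ⟨j, hj⟩ := hv
      -- In an irreducible monomial v_i ≥ p forces u_{i+1} = 0, so v_{i+1} = r_{i+1} ≥ p. Going
      -- round the cycle, only ∏ y_i^{r_i} is left.
      have hall := Fin.forall_of_forall_add_one (P := fun i => p ≤ v i) (fun i hpi => by
        have h1 := hi (i + 1) (by rwa [add_sub_cancel_right])
        have h2 := hr (i + 1)
        rw [← huv, Pi.add_apply] at h2
        omega) hj
      have hu : u = 0 := funext fun i => by
        have := hi i (hall _)
        simp only [Pi.zero_apply]
        omega
      subst hu
      rw [zero_add] at huv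
      subst huv
      refine ⟨(0, 1), ?_⟩
      simp [normalForm]

theorem evalPoint_eq_zero_of_mem_thetaPower (hF : Nat.card F = p ^ f) {r : Fin f → ℕ}
    {P : (symPower p f F r).toSubmodule} (hP : P ∈ (thetaPower p f F hF r 1).toSubmodule) (a b : F) :
    evalPoint p f F a b (P : TwistedPoly f F) = 0 := by
  have : (thetaPower p f F hF r 1).toSubmodule ≤ LinearMap.ker
      ((evalPoint p f F a b).toLinearMap ∘ₗ (symPower p f F r).toSubmodule.subtype) := by
    refine iSup_le fun i P hP => ?_
    obtain ⟨Q, hQ⟩ := hP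
    change evalPoint p f F a b (P : TwistedPoly f F) = 0
    rw [hQ, pow_one, map_mul, evalPoint_theta hF, zero_mul]
  exact this hP

/-- A polynomial of `V_r` that vanishes at all rational points belongs to `V_r^{(1)}`. -/
theorem mem_thetaPower_one_of_evalPoint_eq_zero (hF : Nat.card F = p ^ f) {r : Fin f → ℕ}
    (hr : ∀ i, p ≤ r i) (P : (symPower p f F r).toSubmodule)
    (h0 : evalPoint p f F 0 1 (P : TwistedPoly f F) = 0)
    (h1 : ∀ a, evalPoint p f F 1 a (P : TwistedPoly f F) = 0) :
    P ∈ (thetaPower p f F hF r 1).toSubmodule := by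
  have hne : Nat.card F ≠ 0 := by
    rw [hF]; exact pow_ne_zero _ (Fact.out : p.Prime).ne_zero
  have : Finite F := Nat.finite_of_card_ne_zero hne
  have : Fintype F := Fintype.ofFinite F
  have hmem := mem_of_xyMonomial_mem _
    (fun u v huv => xyMonomial_mem_thetaPower_sup_normalForm hF hr _ u v huv rfl) P.2
  obtain ⟨_, ⟨Q, hQ, rfl⟩, _, ⟨c, rfl⟩, hsum⟩ := Submodule.mem_sup.1 hmem
  have hc : c = 0 := eq_zero_of_evalPoint_normalForm_eq_zero hF hr
    (by
      have := evalPoint_eq_zero_of_mem_thetaPower hF hQ 0 1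
      rwa [← hsum, map_add, Submodule.subtype_apply, this, zero_add] at h0)
    (fun a => by
      have := evalPoint_eq_zero_of_mem_thetaPower hF hQ 1 a
      have h := h1 a
      rwa [← hsum, map_add, Submodule.subtype_apply, this, zero_add] at h)
  rw [hc, map_zero, add_zero] at hsum
  rwa [← Subtype.ext hsum]

end Reduction

/-! ### Monomials in the θ_i and local coordinates at (0, 1). -/

section ThetaMonomials

variable (p f : ℕ) (F : Type*) [Field F] [NeZero f]

/-- The monomial `∏ θᵢ ^ bᵢ`. -/
noncomputable def thetaMonomial (b : Fin f → ℕ) : TwistedPoly f F :=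
  ∏ i, theta p f F i ^ b i

/-- The multidegree of `∏ θᵢ ^ bᵢ`. -/
def thetaWeight (b : Fin f → ℕ) (j : Fin f) : ℕ := b j + p * b (j + 1)

variable {p f F}

theorem isWeightedHomogeneous_thetaMonomial (b : Fin f → ℕ) :
    IsWeightedHomogeneous (multiWeight f) (thetaMonomial p f F b) (thetaWeight p f b) := by
  have h := IsWeightedHomogeneous.prod (w := multiWeight f) Finset.univ
    (fun i => theta p f F i ^ b i) _ fun i _ => (isWeightedHomogeneous_theta i).pow (b i)
  rw [thetaMonomial]
  convert h using 1
  funext j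
  simp only [smul_add, Finset.sum_add_distrib, sum_single_eq, Pi.add_apply, thetaWeight]
  rw [Finset.sum_apply, Fintype.sum_eq_single (j + 1)]
  · simp [mul_comm]
  · intro i hi
    have : j ≠ i - 1 := fun h => hi (by rw [h, sub_add_cancel])
    simp [this]

theorem thetaMonomial_add (b c : Fin f → ℕ) :
    thetaMonomial p f F (b + c) = thetaMonomial p f F b * thetaMonomial p f F c := by
  simp [thetaMonomial, pow_add, Finset.prod_mul_distrib]

theorem thetaMonomial_single (i : Fin f) (n : ℕ) :
    thetaMonomial p f F (Pi.single i n) = theta p f F i ^ n := by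
  rw [thetaMonomial, Fintype.prod_eq_single i]
  · simp
  · intro j hj; simp [hj]

theorem twistedSubst_thetaMonomial [Fact p.Prime] [CharP F p] (hF : Nat.card F = p ^ f)
    (g : Matrix (Fin 2) (Fin 2) F) (b : Fin f → ℕ) :
    twistedSubst p f F g (thetaMonomial p f F b) =
      C (g.det ^ ∑ i : Fin f, p ^ (i : ℕ) * b i) * thetaMonomial p f F b := by
  simp only [thetaMonomial, map_prod, map_pow, twistedSubst_theta p f F hF, mul_pow,
    Finset.prod_mul_distrib]
  congr 1
  simp only [← map_pow, ← map_prod, ← pow_mul, Finset.prod_pow_eq_pow_sum]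

variable (p f F)

/-- Truncations of the series `zᵢ + zᵢ₋₁ ^ p + zᵢ₋₂ ^ (p ^ 2) + ⋯`. -/
noncomputable def frobeniusSeries : ℕ → Fin f → MvPolynomial (Fin f) F
  | 0, _ => 0
  | n + 1, i => X i + frobeniusSeries n (i - 1) ^ p

/-- The expansion `xᵢ ↦ zᵢ + zᵢ₋₁ ^ p + ⋯`, `yᵢ ↦ 1` in the local coordinates `zᵢ = θᵢ` at the point
`(0, 1)`. -/
noncomputable def localExpansion (n : ℕ) : TwistedPoly f F →ₐ[F] MvPolynomial (Fin f) F :=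
  aeval fun v => ![frobeniusSeries p f F n v.1, 1] v.2

variable {p f F}

/-- The p-th power is additive, so consecutive truncations differ by one top term. -/
theorem frobeniusSeries_succ [Fact p.Prime] [CharP F p] (n : ℕ) (i : Fin f) :
    ∃ j, frobeniusSeries p f F (n + 1) i = frobeniusSeries p f F n i + X j ^ p ^ n := by
  induction n generalizing i with
  | zero => exact ⟨i, by simp [frobeniusSeries, (Fact.out : p.Prime).ne_zero]⟩
  | succ n ih =>
    obtain ⟨j, hj⟩ := ih (i - 1)
    refine ⟨j, ?_⟩
    rw [frobeniusSeries, hj, add_pow_char, frobeniusSeries, ← pow_mul, ← pow_succ, add_assoc]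

/-- With y_i = 1, θ_i becomes x_i - x_{i-1}^p and the series telescopes, leaving only the truncation
error. -/
theorem localExpansion_theta [Fact p.Prime] [CharP F p] (n : ℕ) (i : Fin f) :
    ∃ j, X i - localExpansion p f F n (theta p f F i) = X j ^ p ^ n := by
  obtain ⟨j, hj⟩ := frobeniusSeries_succ (p := p) (F := F) n i
  refine ⟨j, ?_⟩
  rw [frobeniusSeries] at hj
  have : localExpansion p f F n (theta p f F i) =
      frobeniusSeries p f F n i - frobeniusSeries p f F n (i - 1) ^ p := by
    simp [localExpansion, theta]
  rw [this]
  linear_combination hj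

theorem constantCoeff_localExpansion [Fact p.Prime] (n : ℕ) (Q : TwistedPoly f F) :
    constantCoeff (localExpansion p f F n Q) = evalPoint p f F 0 1 Q := by
  have hp : p ≠ 0 := (Fact.out : p.Prime).ne_zero
  have hT : ∀ n i, constantCoeff (frobeniusSeries p f F n i) = 0 := by
    intro n
    induction n with
    | zero => intro i; simp [frobeniusSeries]
    | succ n ih => intro i; simp [frobeniusSeries, ih, hp]
  induction Q using MvPolynomial.induction_on with
  | C a => simp [localExpansion, evalPoint]
  | add P Q hP hQ => simp only [map_add, hP, hQ]
  | mul_X P v hP =>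
    simp only [map_mul, hP]
    congr 1
    obtain ⟨i, k⟩ := v
    fin_cases k
    · simp [localExpansion, evalPoint, hT, hp]
    · simp [localExpansion, evalPoint]

/-- Up to high order, `∏ θᵢ ^ bᵢ` is expanded as `∏ zᵢ ^ bᵢ`. -/
theorem coeff_localExpansion_thetaMonomial_mul [Fact p.Prime] [CharP F p] {n : ℕ}
    {a : Fin f →₀ ℕ} (ha : ∀ i, a i < p ^ n) (b : Fin f →₀ ℕ) (Q : TwistedPoly f F) :
    coeff a (localExpansion p f F n (thetaMonomial p f F b * Q)) =
      coeff a (monomial b 1 * localExpansion p f F n Q) := by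
  -- The ideal of the truncation errors z_j^{p^n}; it does not affect coefficients at exponents
  -- below p^n.
  let I : Ideal (MvPolynomial (Fin f) F) := Ideal.span ((fun s => monomial s (1 : F)) ''
    Set.range fun j => Finsupp.single j (p ^ n))
  have hX : ∀ i, Ideal.Quotient.mk I (localExpansion p f F n (theta p f F i)) =
      Ideal.Quotient.mk I (X i) := fun i => by
    obtain ⟨j, hj⟩ := localExpansion_theta (p := p) (F := F) n i
    refine (Ideal.Quotient.eq.2 ?_).symm
    rw [hj, X_pow_eq_monomial]
    exact Ideal.subset_span ⟨_, ⟨j, rfl⟩, rfl⟩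
  have hmem : localExpansion p f F n (thetaMonomial p f F b * Q) -
      monomial b 1 * localExpansion p f F n Q ∈ I := by
    rw [← Ideal.Quotient.eq, map_mul, map_mul, map_mul, thetaMonomial, monomial_eq,
      Finsupp.prod_fintype _ _ (by simp)]
    simp only [map_prod, map_pow, hX, map_one, one_mul]
  rw [← sub_eq_zero, ← coeff_sub]
  by_contra hne
  obtain ⟨_, ⟨j, rfl⟩, hj⟩ := mem_ideal_span_monomial_image.1 hmem a (mem_support_iff.2 hne)
  have := hj j
  rw [Finsupp.single_eq_same] at this
  exact absurd this (not_le.2 (ha j))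

end ThetaMonomials

/-! ### Characters of B and the Bruhat decomposition. -/

section Borel

variable {F : Type*} [Field F]

/-- The character `(a, b; 0, d) ↦ (a * d) ^ s * d ^ t` of the Borel subgroup. -/
noncomputable def borelCharacter (s t : ℕ) : borelSubgroup F →* Fˣ :=
  (Matrix.GeneralLinearGroup.det.comp (borelSubgroup F).subtype) ^ s *
    (MonoidHom.toHomUnits
      { toFun := fun b : borelSubgroup F => b.val.val 1 1
        map_one' := by simp
        map_mul' := fun b c => by
          have hb : b.val.val 1 0 = 0 := b.2
          simp [Matrix.mul_apply, Fin.sum_univ_two, hb] }) ^ t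

theorem coe_borelCharacter (s t : ℕ) (b : borelSubgroup F) :
    (borelCharacter s t b : F) = b.val.val.det ^ s * b.val.val 1 1 ^ t := by
  simp [borelCharacter]

/-- Representatives of the big cell of `B \ GL₂(F)`. -/
def bigCell (a : F) : GL (Fin 2) F :=
  ⟨!![0, 1; 1, a], !![-a, 1; 1, 0], by simp [Matrix.one_fin_two], by simp [Matrix.one_fin_two]⟩

/-- An element of `ind_B^G χ` is determined by its values at representatives of `B \ GL₂(F)`. -/
theorem eq_zero_of_mem_coindV {χ : borelSubgroup F →* Fˣ} {φ : GL (Fin 2) F → F}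
    (hφ : φ ∈ Representation.coindV (borelSubgroup F).subtype (Representation.ofCharacter χ))
    (h0 : φ 1 = 0) (h1 : ∀ a, φ (bigCell a) = 0) : φ = 0 := by
  have key : ∀ (b : borelSubgroup F) (g : GL (Fin 2) F), φ g = 0 → φ (b.val * g) = 0 := by
    intro b g hg
    have := hφ b g
    rw [hg, map_zero] at this
    exact this
  funext g
  by_cases hg : g.val 1 0 = 0
  · simpa using key ⟨g, hg⟩ 1 h0
  · let a := g.val 1 1 / g.val 1 0
    have hmem : g * (bigCell a)⁻¹ ∈ borelSubgroup F := by
      change (g.val * !![-a, 1; 1, 0]) 1 0 = 0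
      simp [Matrix.mul_apply, Fin.sum_univ_two, a]
      field_simp
      ring
    simpa using key ⟨_, hmem⟩ _ (h1 a)

end Borel

/-! ### Spans of theta monomials and the principal series in one step. -/

section ThetaSpan

variable {p f : ℕ} {F : Type*} [Field F] [Fact p.Prime] [CharP F p]

theorem divisibleBy_mono {r : Fin f → ℕ} {P Q : TwistedPoly f F} (h : P ∣ Q) :
    divisibleBy p f F r Q ≤ divisibleBy p f F r P := fun _ hx => dvd_trans h hx

variable [NeZero f]

/-- The sum of the submodules `⟨∏ θᵢ ^ bᵢ⟩` of `V_r`, for exponents `b` in `U`. -/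
noncomputable def thetaSpan (hF : Nat.card F = p ^ f) (r : Fin f → ℕ) (U : Set (Fin f → ℕ)) :
    Subrepresentation (symPowerRep p f F r) where
  toSubmodule := ⨆ b ∈ U, divisibleBy p f F r (thetaMonomial p f F b)
  apply_mem_toSubmodule g := by
    suffices h : (⨆ b ∈ U, divisibleBy p f F r (thetaMonomial p f F b)) ≤
        (⨆ b ∈ U, divisibleBy p f F r (thetaMonomial p f F b)).comap (symPowerRep p f F r g) from
      fun v hv => h hv
    refine iSup₂_le fun b hb P hP => Submodule.mem_comap.2
      (Submodule.mem_iSup_of_mem b (Submodule.mem_iSup_of_mem hb ?_))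
    obtain ⟨Q, hQ⟩ := hP
    change thetaMonomial p f F b ∣ twistedSubst p f F g.val (P : TwistedPoly f F)
    rw [hQ, map_mul, twistedSubst_thetaMonomial hF, mul_assoc]
    exact (dvd_mul_right _ _).mul_left _

theorem mem_thetaSpan_of_dvd (hF : Nat.card F = p ^ f) {r : Fin f → ℕ} {U : Set (Fin f → ℕ)}
    {b : Fin f → ℕ} (hb : b ∈ U) {P : (symPower p f F r).toSubmodule}
    (h : thetaMonomial p f F b ∣ (P : TwistedPoly f F)) : P ∈ (thetaSpan hF r U).toSubmodule :=
  Submodule.mem_iSup_of_mem b (Submodule.mem_iSup_of_mem hb h)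

theorem thetaSpan_mono (hF : Nat.card F = p ^ f) (r : Fin f → ℕ) :
    Monotone (thetaSpan (F := F) hF r) :=
  fun _ _ hUU' => (biSup_mono hUU' : (⨆ b ∈ _, divisibleBy p f F r (thetaMonomial p f F b)) ≤ _)

/-- An exponent with b_i ≥ m gives a multiple of θ_i^m, and the θ_i^m themselves occur. -/
theorem thetaSpan_eq_thetaPower (hF : Nat.card F = p ^ f) (r : Fin f → ℕ) (m : ℕ) :
    thetaSpan hF r {b | ∃ i, m ≤ b i} = thetaPower p f F hF r m := by
  refine Subrepresentation.toSubmodule_injective (le_antisymm ?_ ?_)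
  · refine iSup₂_le fun b ⟨i, hi⟩ => le_iSup_of_le i (divisibleBy_mono ?_)
    exact (pow_dvd_pow _ hi).trans (Finset.dvd_prod_of_mem _ (Finset.mem_univ i))
  · refine iSup_le fun i P hP => mem_thetaSpan_of_dvd hF
      (show Pi.single i m ∈ {b : Fin f → ℕ | ∃ i, m ≤ b i} from ⟨i, by simp⟩) ?_
    rw [thetaMonomial_single]
    exact hP

/-- The coefficient of `∏ zᵢ ^ aᵢ` in the local expansions of the translates of `P`. -/
noncomputable def localCoeff (r : Fin f → ℕ) (n : ℕ) (a : Fin f → ℕ) :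
    (symPower p f F r).toSubmodule →ₗ[F] GL (Fin 2) F → F :=
  LinearMap.pi fun g => lcoeff F (Finsupp.equivFunOnFinite.symm a) ∘ₗ
    (localExpansion p f F n).toLinearMap ∘ₗ (twistedSubst p f F g.val).toLinearMap ∘ₗ
      (symPower p f F r).toSubmodule.subtype

theorem localCoeff_apply (r : Fin f → ℕ) (n : ℕ) (a : Fin f → ℕ)
    (P : (symPower p f F r).toSubmodule) (g : GL (Fin 2) F) :
    localCoeff r n a P g = coeff (Finsupp.equivFunOnFinite.symm a)
      (localExpansion p f F n (twistedSubst p f F g.val (P : TwistedPoly f F))) := rfl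

theorem localCoeff_symPowerRep (r : Fin f → ℕ) (n : ℕ) (a : Fin f → ℕ)
    (P : (symPower p f F r).toSubmodule) (g h : GL (Fin 2) F) :
    localCoeff r n a (symPowerRep p f F r g P) h = localCoeff r n a P (h * g) := by
  have : twistedPolyRep p f F (h * g) (P : TwistedPoly f F) =
      twistedPolyRep p f F h (twistedPolyRep p f F g P) := by rw [map_mul]; rfl
  rw [localCoeff_apply, localCoeff_apply]
  exact congrArg (fun Q => coeff _ (localExpansion p f F n Q)) this.symm

theorem localCoeff_thetaMonomial_mul (hF : Nat.card F = p ^ f) {r : Fin f → ℕ} {n : ℕ}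
    {a : Fin f → ℕ} (ha : ∀ i, a i < p ^ n) (b : Fin f → ℕ) {P : (symPower p f F r).toSubmodule}
    {Q : TwistedPoly f F} (hP : (P : TwistedPoly f F) = thetaMonomial p f F b * Q)
    (g : GL (Fin 2) F) :
    localCoeff r n a P g = g.val.det ^ (∑ i : Fin f, p ^ (i : ℕ) * b i) *
      coeff (Finsupp.equivFunOnFinite.symm a) (monomial (Finsupp.equivFunOnFinite.symm b) 1 *
        localExpansion p f F n (twistedSubst p f F g.val Q)) := by
  rw [localCoeff_apply, hP, map_mul, twistedSubst_thetaMonomial hF, mul_assoc, map_mul,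
    ← algebraMap_eq, AlgHom.commutes, algebraMap_eq, coeff_C_mul]
  congr 1
  exact coeff_localExpansion_thetaMonomial_mul (a := Finsupp.equivFunOnFinite.symm a) ha
    (Finsupp.equivFunOnFinite.symm b) _

theorem localCoeff_thetaMonomial_mul_self (hF : Nat.card F = p ^ f) {r : Fin f → ℕ} {n : ℕ}
    {a : Fin f → ℕ} (ha : ∀ i, a i < p ^ n) {P : (symPower p f F r).toSubmodule}
    {Q : TwistedPoly f F} (hP : (P : TwistedPoly f F) = thetaMonomial p f F a * Q)
    (g : GL (Fin 2) F) :
    localCoeff r n a P g = g.val.det ^ (∑ i : Fin f, p ^ (i : ℕ) * a i) *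
      evalPoint p f F (g.val 1 0) (g.val 1 1) Q := by
  rw [localCoeff_thetaMonomial_mul hF ha a hP, coeff_monomial_mul', if_pos le_rfl, tsub_self,
    one_mul, ← constantCoeff_eq, constantCoeff_localExpansion, evalPoint_twistedSubst]
  simp

/-- A multiple of z^b has no z^a term unless b ≤ a; this makes the local coefficient well defined
modulo the old span. -/
theorem localCoeff_eq_zero_of_mem (hF : Nat.card F = p ^ f) {r : Fin f → ℕ} {n : ℕ}
    {a : Fin f → ℕ} (ha : ∀ i, a i < p ^ n) {U : Set (Fin f → ℕ)} (hU : ∀ b ∈ U, ¬ b ≤ a)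
    {P : (symPower p f F r).toSubmodule} (hP : P ∈ (thetaSpan hF r U).toSubmodule) :
    localCoeff r n a P = 0 := by
  have : (thetaSpan hF r U).toSubmodule ≤ LinearMap.ker (localCoeff r n a) := by
    refine iSup₂_le fun b hb P hP => funext fun g => ?_
    obtain ⟨Q, hQ⟩ := hP
    have h : ¬ Finsupp.equivFunOnFinite.symm b ≤ Finsupp.equivFunOnFinite.symm a := hU b hb
    rw [localCoeff_thetaMonomial_mul hF ha b hQ, coeff_monomial_mul', if_neg h, mul_zero]
    rfl
  exact this hP

theorem exists_of_mem_thetaSpan_insert (hF : Nat.card F = p ^ f) {r r' a : Fin f → ℕ}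
    (hr : thetaWeight p f a + r' = r) {U : Set (Fin f → ℕ)} {P : (symPower p f F r).toSubmodule}
    (hP : P ∈ (thetaSpan hF r (insert a U)).toSubmodule) :
    ∃ (Q : (symPower p f F r').toSubmodule) (P₁ : (symPower p f F r).toSubmodule),
      (P₁ : TwistedPoly f F) = thetaMonomial p f F a * Q ∧
        P - P₁ ∈ (thetaSpan hF r U).toSubmodule := by
  have : (thetaSpan hF r (insert a U)).toSubmodule =
    divisibleBy p f F r (thetaMonomial p f F a) ⊔ (thetaSpan hF r U).toSubmodule := iSup_insert
  rw [this] at hP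
  obtain ⟨P₁, hP₁, P₂, hP₂, rfl⟩ := Submodule.mem_sup.1 hP
  subst hr
  obtain ⟨Q, hQ, hPQ⟩ := exists_isWeightedHomogeneous_of_dvd P₁.2
    (isWeightedHomogeneous_thetaMonomial a) hP₁
  exact ⟨⟨Q, hQ⟩, P₁, hPQ, by rwa [add_sub_cancel_left]⟩

/-- Multiplication by `∏ θᵢ ^ aᵢ` maps `V_{r'}^{(1)}` to the span of the next monomials. -/
theorem mem_thetaSpan_of_mem_thetaPower_one (hF : Nat.card F = p ^ f) {r r' a : Fin f → ℕ}
    (hr : thetaWeight p f a + r' = r) {U : Set (Fin f → ℕ)} (hU : ∀ i, a + Pi.single i 1 ∈ U)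
    {Q : (symPower p f F r').toSubmodule} (hQ : Q ∈ (thetaPower p f F hF r' 1).toSubmodule)
    {P : (symPower p f F r).toSubmodule}
    (hP : (P : TwistedPoly f F) = thetaMonomial p f F a * Q) :
    P ∈ (thetaSpan hF r U).toSubmodule := by
  let μ : (symPower p f F r').toSubmodule →ₗ[F] (symPower p f F r).toSubmodule :=
    (LinearMap.mulLeft F (thetaMonomial p f F a) ∘ₗ
      (symPower p f F r').toSubmodule.subtype).codRestrict _ fun R => by
        subst hr
        exact (isWeightedHomogeneous_thetaMonomial a).mul R.2
  have h : (thetaPower p f F hF r' 1).toSubmodule ≤ (thetaSpan hF r U).toSubmodule.comap μ := by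
    refine iSup_le fun i R hR => mem_thetaSpan_of_dvd hF (hU i) ?_
    rw [thetaMonomial_add, thetaMonomial_single]
    exact mul_dvd_mul_left _ hR
  have hμ : P = μ Q := Subtype.ext hP
  rw [hμ]
  exact h hQ

/-- Adjoining one monomial in the `θᵢ` to the span of the larger ones gives a principal series. -/
theorem exists_thetaSpan_insert_to_indBorel (hF : Nat.card F = p ^ f) {r r' a : Fin f → ℕ}
    (hr : thetaWeight p f a + r' = r) (hr' : ∀ i, p ≤ r' i) {U : Set (Fin f → ℕ)}
    (hU : ∀ b ∈ U, ¬ b ≤ a) (hU' : ∀ i, a + Pi.single i 1 ∈ U) :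
    ∃ (χ : borelSubgroup F →* Fˣ) (β : (thetaSpan hF r (insert a U)).toSubmodule →ₗ[F]
      Representation.coindV (borelSubgroup F).subtype (Representation.ofCharacter χ)),
      Function.Surjective β ∧
      (∀ g y, β ((thetaSpan hF r (insert a U)).toRepresentation g y) = indBorel χ g (β y)) ∧
      ∀ y, β y = 0 ↔ (y : (symPower p f F r).toSubmodule) ∈ (thetaSpan hF r U).toSubmodule := by
  have hne : Nat.card F ≠ 0 := by
    rw [hF]; exact pow_ne_zero _ (Fact.out : p.Prime).ne_zero
  have : Finite F := Nat.finite_of_card_ne_zero hne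
  have : Fintype F := Fintype.ofFinite F
  -- Any truncation order with all a_i < p^n would do.
  let n := ∑ i, a i
  have ha : ∀ i, a i < p ^ n := fun i =>
    (Nat.lt_pow_self (Fact.out : p.Prime).one_lt).trans_le (Nat.pow_le_pow_right
      (Fact.out : p.Prime).pos (Finset.single_le_sum (fun _ _ => Nat.zero_le _) (Finset.mem_univ i)))
  let s := ∑ i : Fin f, p ^ (i : ℕ) * a i
  let t := ∑ i : Fin f, p ^ (i : ℕ) * r' i
  have hval : ∀ {y y₁ : (symPower p f F r).toSubmodule} {Q : (symPower p f F r').toSubmodule},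
      (y₁ : TwistedPoly f F) = thetaMonomial p f F a * Q →
      y - y₁ ∈ (thetaSpan hF r U).toSubmodule → ∀ g : GL (Fin 2) F, localCoeff r n a y g =
        g.val.det ^ s * evalPoint p f F (g.val 1 0) (g.val 1 1) (Q : TwistedPoly f F) := by
    intro y y₁ Q hQ hy g
    have := localCoeff_eq_zero_of_mem hF ha hU hy
    rw [map_sub, sub_eq_zero] at this
    rw [this, localCoeff_thetaMonomial_mul_self hF ha hQ]
  have hmem : ∀ y : (thetaSpan hF r (insert a U)).toSubmodule, localCoeff r n a y.1 ∈
      Representation.coindV (borelSubgroup F).subtype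
        (Representation.ofCharacter (borelCharacter s t)) := by
    intro y b g
    obtain ⟨Q, y₁, hQ, hy⟩ := exists_of_mem_thetaSpan_insert hF hr y.2
    rw [hval hQ hy, hval hQ hy]
    have hb : b.val.val 1 0 = 0 := b.2
    change _ = (borelCharacter s t b : F) • (_ : F)
    rw [coe_borelCharacter, smul_eq_mul]
    have h : ∀ j, (b.val * g).val 1 j = b.val.val 1 1 * g.val 1 j := fun j => by
      simp [Matrix.mul_apply, Fin.sum_univ_two, hb]
    change (b.val * g).val.det ^ s * evalPoint p f F ((b.val * g).val 1 0) ((b.val * g).val 1 1) _ = _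
    rw [h, h, evalPoint_smul Q.2, Units.val_mul, Matrix.det_mul, mul_pow, LinearMap.id_apply]
    simp only [t]
    ring
  let β := ((localCoeff r n a).domRestrict (thetaSpan hF r (insert a U)).toSubmodule).codRestrict
    _ hmem
  refine ⟨borelCharacter s t, β, ?_, ?_, ?_⟩
  · intro φ
    -- The sign compensates det^s, the big cell representatives having determinant -1.
    obtain ⟨c, hc0, hc1⟩ := exists_evalPoint_normalForm_eq hF hr' (φ.1 1)
      (fun x => (-1) ^ s * φ.1 (bigCell x))
    let Q : (symPower p f F r').toSubmodule := ⟨_, isWeightedHomogeneous_normalForm hr' c⟩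
    let y₁ : (symPower p f F r).toSubmodule := ⟨thetaMonomial p f F a * Q, by
      subst hr
      exact (isWeightedHomogeneous_thetaMonomial a).mul Q.2⟩
    let y : (thetaSpan hF r (insert a U)).toSubmodule :=
      ⟨y₁, mem_thetaSpan_of_dvd hF (Set.mem_insert a U) (dvd_mul_right _ _)⟩
    have hy : ∀ g : GL (Fin 2) F, (β y).1 g =
        g.val.det ^ s * evalPoint p f F (g.val 1 0) (g.val 1 1) (normalForm p f F r' c) :=
      hval (y := y₁) (y₁ := y₁) (Q := Q) rfl (by rw [sub_self]; exact zero_mem _)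
    refine ⟨y, ?_⟩
    rw [← sub_eq_zero]
    refine Subtype.ext (eq_zero_of_mem_coindV (β y - φ).2 ?_ fun x => ?_)
    · change (β y).1 1 - φ.1 1 = 0
      rw [hy]
      simp [hc0]
    · change (β y).1 (bigCell x) - φ.1 (bigCell x) = 0
      rw [hy]
      have h1 : (bigCell x).val.det = -1 := by simp [bigCell, Matrix.det_fin_two]
      have h2 : (bigCell x).val 1 0 = 1 := by simp [bigCell]
      have h3 : (bigCell x).val 1 1 = x := by simp [bigCell]
      rw [h1, h2, h3, hc1, ← mul_assoc, ← mul_pow]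
      simp
  · intro g y
    exact Subtype.ext (funext fun h => localCoeff_symPowerRep r n a y.1 g h)
  · intro y
    constructor
    · intro hy
      obtain ⟨Q, y₁, hQ, hyy₁⟩ := exists_of_mem_thetaSpan_insert hF hr y.2
      have h : ∀ g : GL (Fin 2) F,
          evalPoint p f F (g.val 1 0) (g.val 1 1) (Q : TwistedPoly f F) = 0 := fun g => by
        have h0 : localCoeff r n a y.1 g = 0 := congrFun (congrArg Subtype.val hy) g
        rw [hval hQ hyy₁, mul_eq_zero] at h0
        exact h0.resolve_left (pow_ne_zero _ (Matrix.GeneralLinearGroup.det_ne_zero g))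
      -- The identity and the big cell have bottom rows (0, 1) and (1, x), which represent all
      -- points of P^1(F_q).
      have hQ1 : Q ∈ (thetaPower p f F hF r' 1).toSubmodule :=
        mem_thetaPower_one_of_evalPoint_eq_zero hF hr' Q (by simpa using h 1)
          fun x => by simpa [bigCell] using h (bigCell x)
      have := add_mem hyy₁ (mem_thetaSpan_of_mem_thetaPower_one hF hr hU' hQ1 hQ)
      rwa [sub_add_cancel] at this
    · intro hy
      exact Subtype.ext (localCoeff_eq_zero_of_mem hF ha hU hy)

end ThetaSpan

/-! ### Adjoining exponents one by one. -/

section Chain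

variable {p f : ℕ}

/-- A finite set of exponents has a decreasing enumeration. -/
theorem exists_antitone_enumeration (S : Finset (Fin f → ℕ)) :
    ∃ e : Fin S.card → Fin f → ℕ, Function.Injective e ∧ Set.range e = S ∧
      ∀ i j, e i ≤ e j → j ≤ i := by
  -- The lexicographic order is linear and refines the product order; its dual lists larger
  -- exponents first.
  let ι : (Fin f → ℕ) ↪ (Lex (Fin f → ℕ))ᵒᵈ :=
    (toLex.trans OrderDual.toDual).toEmbedding
  have hcard : (S.map ι).card = S.card := Finset.card_map _
  let e := (S.map ι).orderEmbOfFin hcard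
  refine ⟨fun i => ofLex (OrderDual.ofDual (e i)), ?_, ?_, ?_⟩
  · exact fun i j hij => e.injective hij
  · have h := (S.map ι).range_orderEmbOfFin hcard
    ext a
    have ha : ι a ∈ Set.range e ↔ ι a ∈ ((S.map ι : Finset _) : Set (Lex (Fin f → ℕ))ᵒᵈ) := by
      rw [h]
    rw [Finset.mem_coe, Finset.mem_map'] at ha
    exact ha
  · exact fun i j hij => e.le_iff_le.1 (Pi.toLex_monotone hij)

/-- Here the lower bound on r enters: θ^a with all a_i ≤ m has degree at most m + pm in each slot,
so its cofactor keeps degree at least p, as normal forms require. -/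
theorem thetaWeight_add_le [NeZero f] {r : Fin f → ℕ} {m : ℕ} (hr : ∀ i, m + m * p ^ f + p ^ f ≤ r i)
    {a : Fin f → ℕ} (ha : ∀ i, a i ≤ m) (j : Fin f) : thetaWeight p f a j + p ≤ r j := by
  have hp : p ≤ p ^ f := Nat.le_self_pow (NeZero.ne f) p
  calc thetaWeight p f a j + p ≤ m + p * m + p := by
        unfold thetaWeight
        gcongr <;> exact ha _
    _ ≤ m + m * p ^ f + p ^ f := by
        rw [mul_comm p m]
        gcongr
    _ ≤ r j := hr j

variable {F : Type*} [Field F] [Fact p.Prime] [CharP F p] [NeZero f]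

/-- The chain obtained from `V_r^{(m+1)}` by adjoining one by one the monomials in the `θᵢ` with
exponents in `S`. -/
theorem decomposableIntoPrincipalSeries_of_thetaSpan (hF : Nat.card F = p ^ f) {r : Fin f → ℕ}
    {m : ℕ} (hr : ∀ i, m + m * p ^ f + p ^ f ≤ r i) (S : Finset (Fin f → ℕ))
    (hS : ∀ a ∈ S, ∀ i, a i ≤ m) (hup : IsUpperSet ({b | ∃ i, m + 1 ≤ b i} ∪ (S : Set (Fin f → ℕ))))
    {X : Type*} [AddCommGroup X] [Module F X] {σ : Representation F (GL (Fin 2) F) X}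
    (W : Subrepresentation (symPowerRep p f F r)) (π : W.toSubmodule →ₗ[F] X)
    (hπ : Function.Surjective π) (hπρ : ∀ g w, π (W.toRepresentation g w) = σ g (π w))
    (hW : thetaSpan hF r ({b | ∃ i, m + 1 ≤ b i} ∪ S) = W)
    (hker : ∀ w, π w = 0 ↔
      (w : (symPower p f F r).toSubmodule) ∈ (thetaPower p f F hF r (m + 1)).toSubmodule) :
    DecomposableIntoPrincipalSeries σ S.card := by
  obtain ⟨e, he, heS, hanti⟩ := exists_antitone_enumeration S
  have heS' : ∀ i, e i ∈ S := fun i => by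
    have := Set.mem_range_self (f := e) i
    rwa [heS] at this
  let U₀ : Set (Fin f → ℕ) := {b | ∃ i, m + 1 ≤ b i}
  let U : Fin (S.card + 1) → Set (Fin f → ℕ) := fun j => U₀ ∪ e '' {i | i.castSucc < j}
  refine DecomposableIntoPrincipalSeries.of_chain W π hπ hπρ (fun j => thetaSpan hF r (U j))
    (fun j k hjk => thetaSpan_mono hF r (Set.union_subset_union_right _ (Set.image_mono
      fun i hi => lt_of_lt_of_le hi hjk))) ?_ ?_ fun i => ?_
  · rw [← hW]
    congr 2
    have huniv : {i : Fin S.card | i.castSucc < Fin.last S.card} = Set.univ :=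
      Set.eq_univ_of_forall Fin.castSucc_lt_last
    simp only [U, U₀, huniv, Set.image_univ, heS]
  · have h0 : U 0 = U₀ := by simp [U]
    intro w
    change _ ↔ _ ∈ (thetaSpan hF r (U 0)).toSubmodule
    rw [hker, h0, thetaSpan_eq_thetaPower]
  · have hsucc : U i.succ = insert (e i) (U i.castSucc) := by
      have : {k : Fin S.card | k.castSucc < i.succ} = insert i {k | k.castSucc < i.castSucc} := by
        ext k
        simp only [Set.mem_ofPred_eq, Set.mem_insert_iff, Fin.castSucc_lt_succ_iff,
          Fin.castSucc_lt_castSucc_iff]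
        exact le_iff_eq_or_lt
      simp only [U, this, Set.image_insert_eq, Set.union_insert]
    have hle := thetaWeight_add_le hr (hS _ (heS' i))
    rw [hsucc]
    refine exists_thetaSpan_insert_to_indBorel hF (r' := fun j => r j - thetaWeight p f (e i) j)
      ?_ (fun j => ?_) ?_ fun k => ?_
    · funext j
      have := hle j
      simp only [Pi.add_apply]
      omega
    · have := hle j
      omega
    · rintro b (⟨k, hk⟩ | ⟨k, hk, rfl⟩) hb
      · have h1 := hS _ (heS' i) k
        exact absurd (hk.trans ((hb k).trans h1)) (Nat.not_succ_le_self m)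
      · exact absurd (hanti _ _ hb) (not_le.2 hk)
    -- The exponent e_i + e_k is in the upper set; if it belongs to S, it was listed strictly before
    -- e_i because it is strictly larger.
    · rcases hup (le_self_add : e i ≤ e i + Pi.single k 1) (Or.inr (heS' i)) with h | h
      · exact Or.inl h
      · rw [← heS] at h
        obtain ⟨l, hl⟩ := h
        refine Or.inr ⟨l, ?_, hl⟩
        have hil : e i ≤ e l := by rw [hl]; exact le_self_add
        refine lt_of_le_of_ne (hanti _ _ hil) fun hli => ?_
        have := congrFun hl k
        rw [hli] at this
        simp at this

end Chain

theorem mainTheorem2 (p f : ℕ) [Fact p.Prime] [NeZero f] (F : Type*) [Field F] [CharP F p]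
    (hF : Nat.card F = p ^ f) (r : Fin f → ℕ) (m : ℕ)
    (hr : ∀ i, m + m * p ^ f + p ^ f ≤ r i) :
    DecomposableIntoPrincipalSeries
        ((symPowerRep p f F r).subquotient (thetaPower p f F hF r m) (thetaPower p f F hF r (m + 1)))
        ((m + 1) ^ f - m ^ f) ∧
      DecomposableIntoPrincipalSeries
        ((symPowerRep p f F r).quotientBy (thetaPower p f F hF r (m + 1)))
        ((m + 1) ^ f) := by
  classical
  let box : ℕ → Finset (Fin f → ℕ) := fun n => Fintype.piFinset fun _ => Finset.range n
  have hbox : ∀ {n a}, a ∈ box n ↔ ∀ i, a i < n := by simp [box]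
  have hcard : ∀ n, (box n).card = n ^ f := by simp [box]
  have hsub : box m ⊆ box (m + 1) := fun a ha => hbox.2 fun i => (hbox.1 ha i).trans m.lt_succ_self
  -- The shell between the two boxes is what separates V_r^{(m+1)} from V_r^{(m)}.
  have hU₁ : {b | ∃ i, m + 1 ≤ b i} ∪ ((box (m + 1) \ box m : Finset _) : Set (Fin f → ℕ)) =
      {b | ∃ i, m ≤ b i} := by
    ext b
    simp only [Set.mem_union, Set.mem_ofPred_eq, Finset.coe_sdiff, Set.mem_sdiff, Finset.mem_coe,
      hbox, not_forall, not_lt]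
    constructor
    · rintro (⟨i, hi⟩ | ⟨-, h⟩)
      · exact ⟨i, m.le_succ.trans hi⟩
      · exact h
    · intro h
      by_cases hb : ∃ i, m + 1 ≤ b i
      · exact Or.inl hb
      · push Not at hb
        exact Or.inr ⟨hb, h⟩
  have hU₂ : {b | ∃ i, m + 1 ≤ b i} ∪ (box (m + 1) : Set (Fin f → ℕ)) = Set.univ := by
    refine Set.eq_univ_of_forall fun b => ?_
    by_cases hb : ∃ i, m + 1 ≤ b i
    · exact Or.inl hb
    · push Not at hb
      exact Or.inr (hbox.2 hb)
  have hle : ∀ {a}, a ∈ box (m + 1) → ∀ i, a i ≤ m := fun ha i => Nat.le_of_lt_succ (hbox.1 ha i)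
  constructor
  · rw [← hcard, ← hcard, ← Finset.card_sdiff_of_subset hsub]
    refine decomposableIntoPrincipalSeries_of_thetaSpan hF hr _
      (fun a ha => hle (Finset.mem_sdiff.1 ha).1) ?_ (thetaPower p f F hF r m)
      (Submodule.mkQ _) (Submodule.mkQ_surjective _) (fun g w => rfl) ?_ fun w => ?_
    · rw [hU₁]
      exact fun b c hbc ⟨i, hi⟩ => ⟨i, hi.trans (hbc i)⟩
    · rw [hU₁, thetaSpan_eq_thetaPower]
    · rw [Submodule.mkQ_apply, Submodule.Quotient.mk_eq_zero]
      rfl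
  · rw [← hcard]
    refine decomposableIntoPrincipalSeries_of_thetaSpan hF hr _ (fun a ha => hle ha) ?_ ⊤
      (Submodule.mkQ (thetaPower p f F hF r (m + 1)).toSubmodule ∘ₗ Submodule.subtype _)
      (fun x => ?_) (fun g w => rfl) ?_ fun w => ?_
    · rw [hU₂]
      exact isUpperSet_univ
    · obtain ⟨y, rfl⟩ := Submodule.mkQ_surjective _ x
      exact ⟨⟨y, trivial⟩, rfl⟩
    -- V_r is V_r^{(0)}, whose exponent condition b_i ≥ 0 is vacuous.
    · rw [hU₂, ← thetaPower_zero p f F hF r, ← thetaSpan_eq_thetaPower]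
      simp
    · rw [LinearMap.comp_apply, Submodule.mkQ_apply, Submodule.Quotient.mk_eq_zero]
      rfl
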